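/- Let $n\in\mathbb N$, $\mathcal J=\begin{pmatrix}0&I_n\\-I_n&0\end{pmatrix}$, and for $k=0,1,2,\dots$ let $\mathcal S_k=\begin{pmatrix}\mathcal A_k&\mathcal B_k\\ \mathcal C_k&\mathcal D_k\end{pmatrix}\in\mathbb C^{2n\times2n}$ and $\mathcal W_k\in\mathbb C^{n\times n}$ satisfy $\mathcal S_k^*\mathcal J\mathcal S_k=\mathcal J$ and $\mathcal W_k=\mathcal W_k^*>0$. Put $\Psi_k=\begin{pmatrix}\mathcal W_k&0\\0&0\end{pmatrix}$, $\mathcal V_k=-\mathcal J\Psi_k\mathcal S_k$, $\mathcal L(z)_k=\mathcal J(z_k-\mathcal S_kz_{k+1})$, and write $z_k=\begin{pmatrix}x_k\\u_k\end{pmatrix}$ with $x_k,u_k\in\mathbb C^n$. For $\lambda\in\mathbb C$ let $(\mathrm S_\lambda)$ be the system $z_k=(\mathcal S_k+\lambda\mathcal V_k)z_{k+1}$, $k\ge0$. Let $\ell^2_\Psi$ be the space of sequences $z=(z_k)_{k\ge0}$ in $\mathbb C^{2n}$ with $\sum_k z_k^*\Psi_kz_k<\infty$, with the semi-inner product $\langle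 z,u\rangle=\sum_{k\ge0} z_k^*\Psi_ku_k$, and let $\tilde\ell^2_\Psi$ be the Hilbert space of its equivalence classes $[z]$ modulo sequences of zero semi-norm. Let $T_0$ be the linear relation of all pairs $([z],[f])$, $z,f\in\ell^2_\Psi$, such that $\mathcal L(z)_k=\Psi_kf_k$ for all $k\ge0$, $z_0=0$, and $z_k=0$ for all large $k$; let $T_{\min}=\overline{T_0}$ be its closure in $\tilde\ell^2_\Psi\times\tilde\ell^2_\Psi$. Let $T_F$ be the Friedrichs extension of $T_{\min}$, i.e. the linear relation associated with the closure $\bar t$ of the form $t[z,w]=\langle f,w\rangle$, $(z,f)\in T_{\min}$, $w\in\operatorname{dom}T_{\min}$: $(z,f)\in T_F$ if and only if $z\in\operatorname{dom}\bar t$ and $\bar t[z,w]=\langle f,w\rangle$ for all $w\in\operatorname{dom}\bar t$. Assume: 1. (Strong Atkinson condition.) There are $\mu\in\mathbb C$ and a finite discrete interval $[a,b]\subseteq[0,\infty)$ such that $\sum_{k=a}^b z_k^*\Psi_kz_k>0$ for every nontrivial solution $z$ of $(\mathrm S_\mu)$. 2. $\nu\in\mathbb R$ is such that $(\mathrm S_\nu)$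 is disconjugate on $[0,\infty)$: for every integer $N\ge0$ the $2n\times n$ matrix solution $Z=\begin{pmatrix}X\\U\end{pmatrix}$ of $(\mathrm S_\nu)$ with $Z_{N+1}=\begin{pmatrix}0\\-I\end{pmatrix}$ satisfies $\ker X_k\subseteq\ker X_{k+1}$ and $-X_{k+1}X_k^\dagger\mathcal B_k\ge0$ for all $0\le k\le N$, where $\dagger$ is the Moore–Penrose inverse. 3. $(\mathrm S_\nu)$ is eventually controllable: there is $N\ge0$ such that for all integers $N\le K<M$ the only solution of $(\mathrm S_\nu)$ with $x_k=0$ for $K\le k\le M$ is $z\equiv0$. Then $x_0=0$ for every pair $([z],[f])\in T_F$ and every representative $z$ of the class $[z]$. -/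

import Mathlib

open Matrix Filter Topology
open scoped ComplexOrder

/-- The skew-symmetric matrix `J = (0, I; -I, 0)` of order `2n`. -/
def sympJ (n : ℕ) : Matrix (Fin n ⊕ Fin n) (Fin n ⊕ Fin n) ℂ :=
  fromBlocks 0 1 (-1) 0

/-- The coefficients of a discrete symplectic system on `[0,∞)`: symplectic matrices `S k` and
Hermitian positive definite weights `W k`. -/
structure SympSystem (n : ℕ) where
  S : ℕ → Matrix (Fin n ⊕ Fin n) (Fin n ⊕ Fin n) ℂ
  W : ℕ → Matrix (Fin n) (Fin n) ℂ
  symplectic : ∀ k, (S k)ᴴ * sympJ n * S k = sympJ n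
  posDef : ∀ k, (W k).PosDef

namespace SympSystem

variable {n : ℕ} (𝒮 : SympSystem n)

/-- The weight matrix `Ψ k = (W k, 0; 0, 0)`. -/
def Psi (k : ℕ) : Matrix (Fin n ⊕ Fin n) (Fin n ⊕ Fin n) ℂ :=
  fromBlocks (𝒮.W k) 0 0 0

/-- `V k = - J Ψ_k S_k`. -/
def V (k : ℕ) : Matrix (Fin n ⊕ Fin n) (Fin n ⊕ Fin n) ℂ :=
  -(sympJ n * 𝒮.Psi k * 𝒮.S k)

/-- The upper right `n × n` block of `S k`. -/
def B (k : ℕ) : Matrix (Fin n) (Fin n) ℂ := (𝒮.S k).toBlocks₁₂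

/-- The linear map `L(z)_k = J (z_k - S_k z_{k+1})`. -/
def L (z : ℕ → Fin n ⊕ Fin n → ℂ) (k : ℕ) : Fin n ⊕ Fin n → ℂ :=
  sympJ n *ᵥ (z k - 𝒮.S k *ᵥ z (k + 1))

/-! ### Solutions, definiteness, disconjugacy, controllability -/

/-- `z` is a (vector) solution of `z_k = (S_k + lam V_k) z_{k+1}`, `k ≥ 0`. -/
def IsSolution (lam : ℂ) (z : ℕ → Fin n ⊕ Fin n → ℂ) : Prop :=
  ∀ k, z k = (𝒮.S k + lam • 𝒮.V k) *ᵥ z (k + 1)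

/-- `Z` is a `2n × n` matrix solution of `Z_k = (S_k + lam V_k) Z_{k+1}`, `k ≥ 0`. -/
def IsMatrixSolution (lam : ℂ) (Z : ℕ → Matrix (Fin n ⊕ Fin n) (Fin n) ℂ) : Prop :=
  ∀ k, Z k = (𝒮.S k + lam • 𝒮.V k) * Z (k + 1)

/-- The strong Atkinson (definiteness) condition. -/
def StrongAtkinson : Prop :=
  ∃ (mu : ℂ) (a b : ℕ), ∀ z, 𝒮.IsSolution mu z → z ≠ 0 →
    0 < ∑ k ∈ Finset.Icc a b, star (z k) ⬝ᵥ (𝒮.Psi k *ᵥ z k)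

end SympSystem

/-- `P` is the Moore-Penrose generalized inverse of `X` (the four Penrose equations, which have
exactly one solution). -/
structure IsMoorePenrose {n : ℕ} (X P : Matrix (Fin n) (Fin n) ℂ) : Prop where
  mul_mul : X * P * X = X
  mul_mul' : P * X * P = P
  hermitian : (X * P).IsHermitian
  hermitian' : (P * X).IsHermitian

namespace SympSystem

variable {n : ℕ} (𝒮 : SympSystem n)

/-- Disconjugacy on the interval `[M, N + 1]`: the matrix solution with `Z_{N+1} = (0; -I)` satisfies
`ker X_k ⊆ ker X_{k+1}` and `- X_{k+1} X_k† B_k ≥ 0` for all `k` in `[M, N]`. -/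
def DisconjugateOn (lam : ℂ) (M N : ℕ) : Prop :=
  ∀ Z, 𝒮.IsMatrixSolution lam Z → Z (N + 1) = fromRows 0 (-1) →
    ∀ k, M ≤ k → k ≤ N →
      (∀ v, (Z k).toRows₁ *ᵥ v = 0 → (Z (k + 1)).toRows₁ *ᵥ v = 0) ∧
      ∃ P, IsMoorePenrose (Z k).toRows₁ P ∧
        (-((Z (k + 1)).toRows₁ * P * 𝒮.B k)).PosSemidef

/-- Disconjugacy on `[0,∞)`: disconjugacy on `[0, N + 1]` for every `N ≥ 0`. -/
def Disconjugate (lam : ℂ) : Prop :=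
  ∀ N, 𝒮.DisconjugateOn lam 0 N

/-- Complete controllability on `[N,∞)`: for every nondegenerate `[K, M] ⊆ [N,∞)`, the only solution
with `x_k = 0` for all `k` in `[K, M]` is the trivial one. -/
def ControllableFrom (lam : ℂ) (N : ℕ) : Prop :=
  ∀ K M, N ≤ K → K < M → ∀ z, 𝒮.IsSolution lam z →
    (∀ k, K ≤ k → k ≤ M → ∀ i, z k (Sum.inl i) = 0) → z = 0

/-- Eventual controllability. -/
def EventuallyControllable (lam : ℂ) : Prop :=
  ∃ N, 𝒮.ControllableFrom lam N

/-! ### The weighted space of square summable sequences -/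

/-- The summand `z_k^* Ψ_k u_k` of the semi-inner product. -/
noncomputable def term (z u : ℕ → Fin n ⊕ Fin n → ℂ) (k : ℕ) : ℂ :=
  star (z k) ⬝ᵥ (𝒮.Psi k *ᵥ u k)

lemma psi_posSemidef (k : ℕ) : (𝒮.Psi k).PosSemidef := by
  have hW := (𝒮.posDef k).posSemidef
  refine PosSemidef.of_dotProduct_mulVec_nonneg ?_ fun x => ?_
  · have h : (𝒮.W k)ᴴ = 𝒮.W k := hW.1
    simp [IsHermitian, Psi, fromBlocks_conjTranspose, h]
  · have h := hW.dotProduct_mulVec_nonneg (x ∘ Sum.inl)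
    have e : star x ⬝ᵥ (𝒮.Psi k *ᵥ x)
        = star (x ∘ Sum.inl) ⬝ᵥ (𝒮.W k *ᵥ (x ∘ Sum.inl)) := by
      simp [Psi, fromBlocks_mulVec, dotProduct]
    rw [e]
    exact h

lemma term_self_nonneg (z : ℕ → Fin n ⊕ Fin n → ℂ) (k : ℕ) : 0 ≤ 𝒮.term z z k :=
  (𝒮.psi_posSemidef k).dotProduct_mulVec_nonneg _

lemma term_add_left (z w u : ℕ → Fin n ⊕ Fin n → ℂ) (k : ℕ) :
    𝒮.term (z + w) u k = 𝒮.term z u k + 𝒮.term w u k := by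
  simp [term, add_dotProduct]

lemma term_add_right (z w u : ℕ → Fin n ⊕ Fin n → ℂ) (k : ℕ) :
    𝒮.term u (z + w) k = 𝒮.term u z k + 𝒮.term u w k := by
  simp [term, mulVec_add]

lemma term_smul_left (c : ℂ) (z u : ℕ → Fin n ⊕ Fin n → ℂ) (k : ℕ) :
    𝒮.term (c • z) u k = star c * 𝒮.term z u k := by
  simp [term, smul_dotProduct]

lemma term_smul_right (c : ℂ) (z u : ℕ → Fin n ⊕ Fin n → ℂ) (k : ℕ) :
    𝒮.term z (c • u) k = c * 𝒮.term z u k := by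
  simp [term, mulVec_smul]

lemma star_term (z u : ℕ → Fin n ⊕ Fin n → ℂ) (k : ℕ) :
    star (𝒮.term u z k) = 𝒮.term z u k := by
  have h : (𝒮.Psi k)ᴴ = 𝒮.Psi k := (𝒮.psi_posSemidef k).1
  rw [term, term, star_dotProduct, star_star, star_mulVec, h, dotProduct_mulVec]

lemma term_summable_add {z u : ℕ → Fin n ⊕ Fin n → ℂ} (hz : Summable (𝒮.term z z))
    (hu : Summable (𝒮.term u u)) : Summable (𝒮.term (z + u) (z + u)) := by
  refine Summable.of_norm_bounded ((hz.add hu).norm.mul_left 2) fun k => ?_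
  have h1 := 𝒮.term_self_nonneg (z + u) k
  have h2 := 𝒮.term_self_nonneg (z + (-1 : ℂ) • u) k
  have h3 := add_nonneg (𝒮.term_self_nonneg z k) (𝒮.term_self_nonneg u k)
  have e : 𝒮.term (z + u) (z + u) k + 𝒮.term (z + (-1 : ℂ) • u) (z + (-1 : ℂ) • u) k
      = 2 * (𝒮.term z z k + 𝒮.term u u k) := by
    simp only [term_add_left, term_add_right, term_smul_left, term_smul_right, star_neg, star_one]
    ring
  have e' := congrArg Complex.re e
  rw [← Complex.re_eq_norm.2 h1, ← Complex.re_eq_norm.2 h3]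
  have h2' := (Complex.nonneg_iff.1 h2).1
  simp only [Complex.add_re, Complex.mul_re, Complex.re_ofNat, Complex.im_ofNat, zero_mul,
    sub_zero] at e' ⊢
  linarith

lemma term_summable_smul (c : ℂ) {z : ℕ → Fin n ⊕ Fin n → ℂ} (hz : Summable (𝒮.term z z)) :
    Summable (𝒮.term (c • z) (c • z)) := by
  refine (hz.mul_left (star c * c)).congr fun k => ?_
  rw [term_smul_left, term_smul_right, mul_assoc]

lemma term_summable {z u : ℕ → Fin n ⊕ Fin n → ℂ} (hz : Summable (𝒮.term z z))
    (hu : Summable (𝒮.term u u)) : Summable (𝒮.term z u) := by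
  have key (c : ℂ) := 𝒮.term_summable_add hz (𝒮.term_summable_smul c hu)
  refine ((((key 1).sub (key (-1))).sub
    (((key Complex.I).sub (key (-Complex.I))).mul_left Complex.I)).mul_left (1 / 4)).congr
      fun k => ?_
  simp only [term_add_left, term_add_right, term_smul_left, term_smul_right, star_neg, star_one,
    Complex.star_def, Complex.conj_I]
  ring_nf
  simp only [Complex.I_sq]
  ring

/-- The linear space of all sequences `z` with `∑ z_k^* Ψ_k z_k < ∞`. -/
def ellTwo : Submodule ℂ (ℕ → Fin n ⊕ Fin n → ℂ) where
  carrier := {z | Summable (𝒮.term z z)}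
  zero_mem' := by
    have h : 𝒮.term 0 0 = fun _ => 0 := by funext k; simp [term]
    simp only [Set.mem_ofPred_eq, h]
    exact summable_zero
  add_mem' hz hu := 𝒮.term_summable_add hz hu
  smul_mem' c _ hz := 𝒮.term_summable_smul c hz

/-- The space `ellTwo`, as a type that carries only its linear structure (and, below, the topology
of the semi-norm, not that of pointwise convergence). -/
def PreHilb : Type := 𝒮.ellTwo

namespace PreHilb

variable {𝒮}

noncomputable instance : AddCommGroup 𝒮.PreHilb := inferInstanceAs (AddCommGroup 𝒮.ellTwo)

noncomputable instance : Module ℂ 𝒮.PreHilb := inferInstanceAs (Module ℂ 𝒮.ellTwo)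

/-- The sequence underlying an element of the space. -/
def seq (z : 𝒮.PreHilb) : ℕ → Fin n ⊕ Fin n → ℂ := Subtype.val (p := (· ∈ 𝒮.ellTwo)) z

/-- The first component `x_k` of `z_k = (x_k, u_k)`. -/
def x (z : 𝒮.PreHilb) (k : ℕ) : Fin n → ℂ := fun i => z.seq k (Sum.inl i)

lemma summable_term (z u : 𝒮.PreHilb) : Summable (𝒮.term z.seq u.seq) :=
  𝒮.term_summable z.2 u.2

@[simp] lemma seq_add (z u : 𝒮.PreHilb) : (z + u).seq = z.seq + u.seq := rfl

@[simp] lemma seq_smul (c : ℂ) (z : 𝒮.PreHilb) : (c • z).seq = c • z.seq := rfl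

@[simp] lemma seq_zero : (0 : 𝒮.PreHilb).seq = 0 := rfl

end PreHilb

/-- The semi-inner product `⟨z, u⟩ = ∑ z_k^* Ψ_k u_k`. -/
@[reducible]
noncomputable def core : PreInnerProductSpace.Core ℂ 𝒮.PreHilb where
  inner z u := ∑' k, 𝒮.term z.seq u.seq k
  conj_inner_symm z u := by
    rw [starRingEnd_apply, tsum_star]
    exact tsum_congr fun k => 𝒮.star_term _ _ k
  re_inner_nonneg z :=
    (Complex.nonneg_iff.1 (tsum_nonneg fun k => 𝒮.term_self_nonneg z.seq k)).1
  add_left z u w := by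
    rw [← (PreHilb.summable_term z w).tsum_add (PreHilb.summable_term u w)]
    exact tsum_congr fun k => 𝒮.term_add_left _ _ _ k
  smul_left z u c := by
    rw [← tsum_mul_left]
    exact tsum_congr fun k => 𝒮.term_smul_left _ _ _ k

noncomputable instance : SeminormedAddCommGroup 𝒮.PreHilb :=
  @InnerProductSpace.Core.toSeminormedAddCommGroup ℂ 𝒮.PreHilb _ _ _ 𝒮.core

noncomputable instance : InnerProductSpace ℂ 𝒮.PreHilb := InnerProductSpace.ofCore 𝒮.core

/-- The Hilbert space of equivalence classes of square summable sequences, two sequences being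
equivalent when the semi-norm of their difference vanishes. -/
abbrev Hilb : Type := SeparationQuotient 𝒮.PreHilb

/-- The equivalence class of a square summable sequence. -/
noncomputable def cls (z : 𝒮.PreHilb) : 𝒮.Hilb := SeparationQuotient.mk z

/-! ### The maximal, pre-minimal and minimal linear relations -/

/-- The sequences `z`, `f` satisfy `L(z)_k = Ψ_k f_k` for all `k`. -/
def Solves (z f : 𝒮.PreHilb) : Prop :=
  ∀ k, 𝒮.L z.seq k = 𝒮.Psi k *ᵥ f.seq k

variable {𝒮} in
lemma Solves.add {z f z' f' : 𝒮.PreHilb} (h : 𝒮.Solves z f) (h' : 𝒮.Solves z' f') :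
    𝒮.Solves (z + z') (f + f') := fun k => by
  have e : 𝒮.L (z + z').seq k = 𝒮.L z.seq k + 𝒮.L z'.seq k := by
    simp only [L, PreHilb.seq_add, Pi.add_apply, mulVec_add, mulVec_sub]
    abel
  rw [e, h k, h' k, PreHilb.seq_add, Pi.add_apply, mulVec_add]

variable {𝒮} in
lemma Solves.smul (c : ℂ) {z f : 𝒮.PreHilb} (h : 𝒮.Solves z f) :
    𝒮.Solves (c • z) (c • f) := fun k => by
  have e : 𝒮.L (c • z).seq k = c • 𝒮.L z.seq k := by
    simp only [L, PreHilb.seq_smul, Pi.smul_apply, mulVec_smul, mulVec_sub, smul_sub]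
  rw [e, h k, PreHilb.seq_smul, Pi.smul_apply, mulVec_smul]

lemma Solves.zero : 𝒮.Solves 0 0 := fun k => by simp [L]

/-- The maximal linear relation. -/
noncomputable def Tmax : Submodule ℂ (𝒮.Hilb × 𝒮.Hilb) where
  carrier := {p | ∃ z f, 𝒮.cls z = p.1 ∧ 𝒮.cls f = p.2 ∧ 𝒮.Solves z f}
  zero_mem' := ⟨0, 0, rfl, rfl, Solves.zero 𝒮⟩
  add_mem' := by
    rintro _ _ ⟨z, f, hz, hf, h⟩ ⟨z', f', hz', hf', h'⟩
    exact ⟨z + z', f + f', by rw [Prod.fst_add, ← hz, ← hz']; rfl,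
      by rw [Prod.snd_add, ← hf, ← hf']; rfl, h.add h'⟩
  smul_mem' := by
    rintro c _ ⟨z, f, hz, hf, h⟩
    exact ⟨c • z, c • f, by rw [Prod.smul_fst, ← hz]; rfl, by rw [Prod.smul_snd, ← hf]; rfl,
      h.smul c⟩

/-- The pre-minimal linear relation: the pairs of `Tmax` whose solving representative `z` satisfies
`z_0 = 0` and `z_k = 0` for all large `k`. -/
noncomputable def Tpre : Submodule ℂ (𝒮.Hilb × 𝒮.Hilb) where
  carrier := {p | ∃ z f, 𝒮.cls z = p.1 ∧ 𝒮.cls f = p.2 ∧ 𝒮.Solves z f ∧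
    z.seq 0 = 0 ∧ ∃ K, ∀ k, K ≤ k → z.seq k = 0}
  zero_mem' := ⟨0, 0, rfl, rfl, Solves.zero 𝒮, rfl, 0, fun _ _ => rfl⟩
  add_mem' := by
    rintro _ _ ⟨z, f, hz, hf, h, h0, K, hK⟩ ⟨z', f', hz', hf', h', h0', K', hK'⟩
    refine ⟨z + z', f + f', by rw [Prod.fst_add, ← hz, ← hz']; rfl,
      by rw [Prod.snd_add, ← hf, ← hf']; rfl, h.add h', ?_, max K K', fun k hk => ?_⟩
    · simp [h0, h0']
    · simp [hK k (le_of_max_le_left hk), hK' k (le_of_max_le_right hk)]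
  smul_mem' := by
    rintro c _ ⟨z, f, hz, hf, h, h0, K, hK⟩
    refine ⟨c • z, c • f, by rw [Prod.smul_fst, ← hz]; rfl, by rw [Prod.smul_snd, ← hf]; rfl,
      h.smul c, ?_, K, fun k hk => ?_⟩
    · simp [h0]
    · simp [hK k hk]

lemma Tpre_le_Tmax : 𝒮.Tpre ≤ 𝒮.Tmax := by
  rintro _ ⟨z, f, hz, hf, h, -⟩
  exact ⟨z, f, hz, hf, h⟩

/-- The minimal linear relation: the closure of the pre-minimal one. -/
noncomputable def Tmin : Submodule ℂ (𝒮.Hilb × 𝒮.Hilb) := 𝒮.Tpre.topologicalClosure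

end SympSystem

/-! ### The Friedrichs extension of a semibounded linear relation -/

section Friedrichs

variable {H : Type*} [NormedAddCommGroup H] [InnerProductSpace ℂ H]

/-- For a semibounded linear relation `T` let `t` be the form `t[z, w] = ⟨f, w⟩`, `(z, f) ∈ T`,
`w ∈ dom T`. The sequence of pairs `(z_j, f_j) = q j` of `T` converges to `z` with respect to `t`:
`z_j → z` and `t[z_j - z_m] = ⟨f_j - f_m, z_j - z_m⟩ → 0` as `j, m → ∞`. -/
structure FormConverges (T : Submodule ℂ (H × H)) (q : ℕ → H × H) (z : H) : Prop where
  mem : ∀ j, q j ∈ T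
  tendsto : Tendsto (fun j => (q j).1) atTop (𝓝 z)
  cauchy : Tendsto
    (fun p : ℕ × ℕ => inner ℂ ((q p.1).2 - (q p.2).2) ((q p.1).1 - (q p.2).1)) atTop (𝓝 0)

/-- The domain of the closure of the form `t`. -/
def closedFormDomain (T : Submodule ℂ (H × H)) : Set H :=
  {z | ∃ q, FormConverges T q z}

/-- `c` is the value at `(z, w)` of the closure of the form `t`, i.e. `t[z_j, w_j] → c` whenever
`z_j → z` and `w_j → w` with respect to `t`. -/
def HasClosedFormValue (T : Submodule ℂ (H × H)) (z w : H) (c : ℂ) : Prop :=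
  ∀ q r, FormConverges T q z → FormConverges T r w →
    Tendsto (fun j => inner ℂ (q j).2 (r j).1) atTop (𝓝 c)

/-- The Friedrichs extension of a semibounded linear relation `T`: the self-adjoint relation that the
first representation theorem attaches to the closure of the form `t`. It consists of the pairs
`(z, f)` with `z` in the domain of the closed form and `t[z, w] = ⟨f, w⟩` for all `w` in that
domain. -/
def friedrichs (T : Submodule ℂ (H × H)) : Set (H × H) :=
  {p | p.1 ∈ closedFormDomain T ∧
    ∀ w ∈ closedFormDomain T, HasClosedFormValue T p.1 w (inner ℂ p.2 w)}

end Friedrichs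

namespace SympSystem

variable {n : ℕ} (𝒮 : SympSystem n)

/-! The condition `x_0 = 0` survives every limit that leads from the pre-minimal relation to its
Friedrichs extension. Pairing a class with a fixed sequence concentrated at `k = 0` gives `v^* W_0
x_0`, a norm-continuous functional. Since `W_0 > 0`, these functionals detect whether `x_0`
vanishes, so `x_0 = 0` depends only on the class and cuts out a closed set, `initZero`. That set
contains the domain of the pre-minimal relation, hence that of its closure, hence the domain of the
closed form, whose elements are in particular norm limits of elements of `dom T_min`. First
components of the Friedrichs extension lie in this form domain. -/

lemma term_eq_inl (z u : ℕ → Fin n ⊕ Fin n → ℂ) (k : ℕ) :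
    𝒮.term z u k = star (z k ∘ Sum.inl) ⬝ᵥ (𝒮.W k *ᵥ (u k ∘ Sum.inl)) := by
  simp [term, Psi, fromBlocks_mulVec, dotProduct]

/-- The sequence with first component `v` at `k = 0` and all other entries zero. -/
def single (v : Fin n → ℂ) : 𝒮.PreHilb :=
  (⟨Pi.single 0 (Sum.elim v 0), summable_of_ne_finset_zero (s := {0}) fun k hk => by
    have hk' : k ≠ 0 := by simpa using hk
    simp [term, hk']⟩ : 𝒮.ellTwo)

lemma seq_single (v : Fin n → ℂ) : (𝒮.single v).seq = Pi.single 0 (Sum.elim v 0) := rfl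

lemma inner_cls (z u : 𝒮.PreHilb) :
    inner ℂ (𝒮.cls z) (𝒮.cls u) = ∑' k, 𝒮.term z.seq u.seq k :=
  SeparationQuotient.inner_mk_mk z u

/-- Only the summand `k = 0` survives, so `x_0` is seen by continuous functionals on the quotient.
-/
lemma inner_cls_single (v : Fin n → ℂ) (z : 𝒮.PreHilb) :
    inner ℂ (𝒮.cls (𝒮.single v)) (𝒮.cls z) = star v ⬝ᵥ (𝒮.W 0 *ᵥ z.x 0) := by
  rw [inner_cls, tsum_eq_single 0 fun k hk => by simp [term, seq_single, hk], term_eq_inl,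
    seq_single, Pi.single_eq_same, Sum.elim_comp_inl]
  rfl

/-- The classes of the sequences with `x_0 = 0`, described by orthogonality. -/
def initZero : Set 𝒮.Hilb := {p | ∀ v, inner ℂ (𝒮.cls (𝒮.single v)) p = 0}

/-- An intersection of kernels of continuous functionals. -/
lemma isClosed_initZero : IsClosed 𝒮.initZero := by
  simp only [initZero, Set.ofPred_forall]
  exact isClosed_iInter fun v => isClosed_eq (by fun_prop) continuous_const

/-- The first component at `k = 0` is determined by the class, since `W 0` is definite. -/
lemma cls_mem_initZero_iff (z : 𝒮.PreHilb) : 𝒮.cls z ∈ 𝒮.initZero ↔ z.x 0 = 0 := by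
  simp only [initZero, Set.mem_ofPred_eq, inner_cls_single]
  refine ⟨fun h => ?_, fun h v => by simp [h]⟩
  by_contra hx
  -- Test with `v = x_0`: the pairing is then `x_0^* W_0 x_0 > 0`.
  exact ((𝒮.posDef 0).dotProduct_mulVec_pos hx).ne' (h _)

/-- The representative that solves the system has `z_0 = 0`, and one representative decides for the
whole class. -/
lemma fst_mem_initZero_of_mem_Tpre {p : 𝒮.Hilb × 𝒮.Hilb} (hp : p ∈ 𝒮.Tpre) :
    p.1 ∈ 𝒮.initZero := by
  obtain ⟨z, f, hz, -, -, h0, -⟩ := hp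
  rw [← hz, cls_mem_initZero_iff]
  funext i
  simp [PreHilb.x, h0]

/-- The closure is taken in the product, where the constraint on the first component is the preimage
of a closed set under a continuous projection. -/
lemma fst_mem_initZero_of_mem_Tmin {p : 𝒮.Hilb × 𝒮.Hilb} (hp : p ∈ 𝒮.Tmin) :
    p.1 ∈ 𝒮.initZero :=
  closure_minimal (fun _ hq => 𝒮.fst_mem_initZero_of_mem_Tpre hq)
    (𝒮.isClosed_initZero.preimage continuous_fst) hp

/-- Convergence with respect to the form includes convergence in norm, which is enough to stay in a
closed set. -/
lemma closedFormDomain_Tmin_subset : closedFormDomain 𝒮.Tmin ⊆ 𝒮.initZero := by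
  rintro z ⟨q, hq⟩
  exact 𝒮.isClosed_initZero.mem_of_tendsto hq.tendsto
    (Eventually.of_forall fun j => 𝒮.fst_mem_initZero_of_mem_Tmin (hq.mem j))

end SympSystem

theorem lemma3p1 {n : ℕ} (𝒮 : SympSystem n) (hdef : 𝒮.StrongAtkinson) (nu : ℝ)
    (hdisc : 𝒮.Disconjugate (nu : ℂ)) (hctrl : 𝒮.EventuallyControllable (nu : ℂ))
    (z f : 𝒮.PreHilb) (hzf : (𝒮.cls z, 𝒮.cls f) ∈ friedrichs 𝒮.Tmin) :
    z.x 0 = 0 :=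
  (𝒮.cls_mem_initZero_iff z).1 (𝒮.closedFormDomain_Tmin_subset hzf.1)
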